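/- Let $\phi:[0,\infty)\to[0,\infty)$ satisfy: $\phi(0)=0$; $\phi$ is differentiable on $[0,\infty)$ (one-sidedly at $0$); $t\mapsto\phi(t)/t$ is increasing (not necessarily strictly) on $(0,\infty)$; $\lim_{t\to\infty}\phi(t)/t=\infty$; and $\phi'(t)e^{-g\phi(t)-\nu t}$ is a Schwartz function on $[0,\infty)$ for all $g>0$, $\nu\in\mathbb R$. For $g>0$ and $\nu\in\mathbb R$ put $p(t)=e^{-g\phi(t)-\nu t}$ and $$k_0(t,s)=\sqrt{p(t)}\sqrt{p(s)}\,e^{-t}e^{-s}I_0(2\sqrt{st}),\qquad I_0(z)=\sum_{m=0}^\infty\frac{1}{m!\,m!}\Big(\frac z2\Big)^{2m},$$ and let $Q=Q(g,\nu)$ be the bounded operator $Qf(t)=\int_0^\infty f(s)k_0(t,s)\,ds$ on the real space $L^2[0,\infty)$, with inner product $\langle f,h\rangle=\int_0^\infty f(t)h(t)\,dt$. The critical parameter $\nu_c(g)$ is the value of $\nu$ for which the operator norm satisfies $\|Q(g,\nu)\|=1$. Fix $g_0>0$ and $\nu_0=\nu_c(g_0)$, write $Q=Q(g_0,\nu_0)$,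 and let $h_0$ be the positive normalized leading eigenvector of $Q$, i.e. $Qh_0=h_0$, $h_0>0$ (almost everywhere) and $\|h_0\|_2=1$. Then the functions $t\,h_0(t)$ and $\phi(t)h_0(t)$ belong to $L^2[0,\infty)$, the integrals $\int_0^\infty\phi(s)h_0(s)^2\,ds$ and $\int_0^\infty s\,h_0(s)^2\,ds$ are strictly positive, and for every integer $n\ge 0$, $$\frac{\big\langle Q^n[t\,h_0(t)](s),\ \phi(s)h_0(s)\big\rangle}{\int_0^\infty\phi(s)h_0(s)^2\,ds}\ \ge\ \frac{\big\langle Q^n[t\,h_0(t)](s),\ s\,h_0(s)\big\rangle}{\int_0^\infty s\,h_0(s)^2\,ds},$$ with strict inequality for $n=0$. -/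

import Mathlib

open MeasureTheory Set Filter Topology
open scoped ContDiff

namespace WSAW

/-! ### Integral operators with square-integrable kernel on real `L²` -/

section IntegralOperator

variable {α : Type*} [MeasurableSpace α] {μ : Measure α}

theorem ae_memLp_kernel [SFinite μ] {K : α × α → ℝ} (hK : MemLp K 2 (μ.prod μ)) :
    ∀ᵐ t ∂μ, MemLp (fun s => K (t, s)) 2 μ := by
  have h1 : ∀ᵐ t ∂μ, AEStronglyMeasurable (fun s => K (t, s)) μ := hK.1.prodMk_left
  have h2 := ((memLp_two_iff_integrable_sq hK.1).1 hK).prod_right_ae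
  filter_upwards [h1, h2] with t ht1 ht2
  exact (memLp_two_iff_integrable_sq ht1).2 ht2

theorem sq_integral_mul_le {u v : α → ℝ} (hu : MemLp u 2 μ) (hv : MemLp v 2 μ) :
    (∫ s, u s * v s ∂μ) ^ 2 ≤ (∫ s, u s ^ 2 ∂μ) * ∫ s, v s ^ 2 ∂μ := by
  have key : ∀ {a b : α → ℝ} (ha : MemLp a 2 μ) (hb : MemLp b 2 μ),
      inner ℝ (ha.toLp a) (hb.toLp b) = ∫ s, b s * a s ∂μ := by
    intro a b ha hb
    rw [L2.inner_def]
    refine integral_congr_ae ?_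
    filter_upwards [ha.coeFn_toLp, hb.coeFn_toLp] with s h1 h2
    simp [h1, h2]
  have h := real_inner_mul_inner_self_le (hv.toLp v) (hu.toLp u)
  rw [key, key, key] at h
  simp only [← sq] at h
  rw [mul_comm]
  exact h

theorem sq_norm_eq_integral (f : Lp ℝ 2 μ) : ‖f‖ ^ 2 = ∫ s, f s ^ 2 ∂μ := by
  rw [← real_inner_self_eq_norm_sq, L2.inner_def]
  simp [sq]

theorem sq_kernel_apply_le [SFinite μ] {K : α × α → ℝ} (hK : MemLp K 2 (μ.prod μ))
    (f : Lp ℝ 2 μ) :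
    ∀ᵐ t ∂μ, (∫ s, K (t, s) * f s ∂μ) ^ 2 ≤ (∫ s, K (t, s) ^ 2 ∂μ) * ‖f‖ ^ 2 := by
  filter_upwards [ae_memLp_kernel hK] with t ht
  rw [sq_norm_eq_integral]
  exact sq_integral_mul_le ht (Lp.memLp f)

theorem memLp_kernel_apply [SFinite μ] {K : α × α → ℝ} (hK : MemLp K 2 (μ.prod μ))
    (f : Lp ℝ 2 μ) : MemLp (fun t => ∫ s, K (t, s) * f s ∂μ) 2 μ := by
  have hm : AEStronglyMeasurable (fun t => ∫ s, K (t, s) * f s ∂μ) μ := by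
    refine AEStronglyMeasurable.integral_prod_right' (f := fun z : α × α => K z * f z.2) ?_
    exact hK.1.mul (Lp.aestronglyMeasurable f).comp_snd
  refine (memLp_two_iff_integrable_sq hm).2 ?_
  refine Integrable.mono'
    ((((memLp_two_iff_integrable_sq hK.1).1 hK).integral_prod_left).mul_const (‖f‖ ^ 2))
    (hm.pow 2) ?_
  filter_upwards [sq_kernel_apply_le hK f] with t ht
  rwa [Real.norm_of_nonneg (sq_nonneg _)]

/-- The integral operator `(K f)(t) = ∫ K(t, s) f(s) dμ(s)` on `L²(μ)`, for a square-integrable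
kernel `K`. -/
noncomputable def integralOperator [SFinite μ] (K : α × α → ℝ) (hK : MemLp K 2 (μ.prod μ)) :
    Lp ℝ 2 μ →L[ℝ] Lp ℝ 2 μ :=
  LinearMap.mkContinuous
    { toFun := fun f => (memLp_kernel_apply hK f).toLp (fun t => ∫ s, K (t, s) * f s ∂μ)
      map_add' := by
        intro f g
        rw [← MemLp.toLp_add, MemLp.toLp_eq_toLp_iff]
        filter_upwards [ae_memLp_kernel hK] with t ht
        have hf : Integrable (fun s => K (t, s) * f s) μ := ht.integrable_mul (Lp.memLp f)
        have hg : Integrable (fun s => K (t, s) * g s) μ := ht.integrable_mul (Lp.memLp g)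
        rw [Pi.add_apply, ← integral_add hf hg]
        refine integral_congr_ae ?_
        filter_upwards [Lp.coeFn_add f g] with s hs
        rw [hs, Pi.add_apply, mul_add]
      map_smul' := by
        intro c f
        rw [RingHom.id_apply, ← MemLp.toLp_const_smul, MemLp.toLp_eq_toLp_iff]
        refine Eventually.of_forall fun t => ?_
        rw [Pi.smul_apply, smul_eq_mul, ← integral_const_mul]
        refine integral_congr_ae ?_
        filter_upwards [Lp.coeFn_smul c f] with s hs
        rw [hs, Pi.smul_apply, smul_eq_mul]
        ring }
    (Real.sqrt (∫ t, ∫ s, K (t, s) ^ 2 ∂μ ∂μ))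
    (by
      intro f
      refine abs_le_of_sq_le_sq' ?_ (by positivity) |>.2
      have h0 : 0 ≤ ∫ t, ∫ s, K (t, s) ^ 2 ∂μ ∂μ :=
        integral_nonneg fun t => integral_nonneg fun s => sq_nonneg _
      rw [mul_pow, Real.sq_sqrt h0, sq_norm_eq_integral, ← integral_mul_const]
      have hfi := memLp_kernel_apply hK f
      have hae : ∀ᵐ t ∂μ, (hfi.toLp (fun t => ∫ s, K (t, s) * f s ∂μ)) t ^ 2
          ≤ (∫ s, K (t, s) ^ 2 ∂μ) * ‖f‖ ^ 2 := by
        filter_upwards [hfi.coeFn_toLp, sq_kernel_apply_le hK f] with t h1 h2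
        rw [h1]
        exact h2
      exact integral_mono_ae (Lp.memLp _).integrable_sq
        ((((memLp_two_iff_integrable_sq hK.1).1 hK).integral_prod_left).mul_const (‖f‖ ^ 2)) hae)

end IntegralOperator

/-! ### The interaction `φ` -/

/-- A function `f`, considered on `[0, ∞)` only, is a Schwartz function there: it is smooth up to
the boundary point `0` (one-sided derivatives), and each derivative decays faster than every
power. -/
def IsSchwartzOnHalfLine (f : ℝ → ℝ) : Prop :=
  ContDiffOn ℝ ∞ f (Ici 0) ∧
    ∀ k n : ℕ, ∃ C : ℝ, ∀ t : ℝ, 0 ≤ t → t ^ k * |iteratedDerivWithin n f (Ici 0) t| ≤ C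

/-- The weight `p(t) = exp (-g φ(t) - ν t)`. -/
noncomputable def weight (φ : ℝ → ℝ) (g ν t : ℝ) : ℝ := Real.exp (-g * φ t - ν * t)

/-- The assumptions on the interaction `φ : [0, ∞) → [0, ∞)`. Only the values of `φ` on `[0, ∞)`
matter. "Increasing" is meant in the weak sense. -/
structure IsInteraction (φ : ℝ → ℝ) : Prop where
  nonneg : ∀ t, 0 ≤ t → 0 ≤ φ t
  zero : φ 0 = 0
  differentiable : DifferentiableOn ℝ φ (Ici 0)
  monotone_div : MonotoneOn (fun t => φ t / t) (Ioi 0)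
  tendsto_div : Tendsto (fun t => φ t / t) atTop atTop
  schwartz : ∀ g ν : ℝ, 0 < g →
    IsSchwartzOnHalfLine (fun t => derivWithin φ (Ici 0) t * weight φ g ν t)

/-! ### The operator `Q` -/

/-- The modified Bessel function of the first kind of order `0`, on the real line. -/
noncomputable def besselI0 (z : ℝ) : ℝ :=
  ∑' m : ℕ, (1 / ((m.factorial : ℝ) * (m.factorial : ℝ))) * (z / 2) ^ (2 * m)

/-- The kernel `k₀(t, s) = √p(t) √p(s) e^{-t} e^{-s} I₀(2 √(s t))`. -/
noncomputable def kernel (φ : ℝ → ℝ) (g ν : ℝ) (z : ℝ × ℝ) : ℝ :=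
  Real.sqrt (weight φ g ν z.1) * Real.sqrt (weight φ g ν z.2) * Real.exp (-z.1) *
    Real.exp (-z.2) * besselI0 (2 * Real.sqrt (z.2 * z.1))

/-- Lebesgue measure on `[0, ∞)`. -/
noncomputable def halfLine : Measure ℝ := volume.restrict (Ici 0)

noncomputable instance : SFinite halfLine := by unfold halfLine; infer_instance

theorem besselI0_term_le (z : ℝ) (m : ℕ) :
    (1 / ((m.factorial : ℝ) * (m.factorial : ℝ))) * (z / 2) ^ (2 * m)
      ≤ Real.exp (|z| / 2) * ((|z| / 2) ^ m / (m.factorial : ℝ)) := by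
  have h := Real.pow_div_factorial_le_exp (x := |z| / 2) (by positivity) m
  have e : (1 / ((m.factorial : ℝ) * (m.factorial : ℝ))) * (z / 2) ^ (2 * m)
      = ((|z| / 2) ^ m / (m.factorial : ℝ)) * ((|z| / 2) ^ m / (m.factorial : ℝ)) := by
    rw [pow_mul, ← sq_abs (z / 2), abs_div, abs_two, ← pow_mul, mul_comm 2 m, pow_mul]
    ring
  rw [e]
  exact mul_le_mul_of_nonneg_right h (by positivity)

theorem besselI0_term_nonneg (z : ℝ) (m : ℕ) :
    0 ≤ (1 / ((m.factorial : ℝ) * (m.factorial : ℝ))) * (z / 2) ^ (2 * m) := by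
  rw [pow_mul]; positivity

theorem hasSum_exp_bound (x : ℝ) :
    HasSum (fun m : ℕ => Real.exp x * (x ^ m / (m.factorial : ℝ))) (Real.exp x * Real.exp x) := by
  have h := NormedSpace.expSeries_div_hasSum_exp (𝔸 := ℝ) x
  rw [← Real.exp_eq_exp_ℝ] at h
  exact h.mul_left _

theorem besselI0_summable (z : ℝ) :
    Summable fun m : ℕ => (1 / ((m.factorial : ℝ) * (m.factorial : ℝ))) * (z / 2) ^ (2 * m) :=
  Summable.of_nonneg_of_le (besselI0_term_nonneg z) (besselI0_term_le z)
    (hasSum_exp_bound (|z| / 2)).summable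

theorem besselI0_nonneg (z : ℝ) : 0 ≤ besselI0 z := tsum_nonneg (besselI0_term_nonneg z)

theorem besselI0_le (z : ℝ) : besselI0 z ≤ Real.exp |z| := by
  have h := (besselI0_summable z).tsum_le_tsum (besselI0_term_le z)
    (hasSum_exp_bound (|z| / 2)).summable
  rw [(hasSum_exp_bound (|z| / 2)).tsum_eq, ← Real.exp_add, add_halves] at h
  exact h

theorem measurable_besselI0 : Measurable besselI0 := by
  refine measurable_of_tendsto_metrizable
    (f := fun (n : ℕ) (z : ℝ) =>
      ∑ m ∈ Finset.range n, (1 / ((m.factorial : ℝ) * (m.factorial : ℝ))) * (z / 2) ^ (2 * m)) ?_ ?_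
  · intro n
    fun_prop
  · rw [tendsto_pi_nhds]
    intro z
    exact (besselI0_summable z).hasSum.tendsto_sum_nat

theorem aemeasurable_interaction {φ : ℝ → ℝ} (hφ : IsInteraction φ) :
    AEMeasurable φ halfLine :=
  hφ.differentiable.continuousOn.aemeasurable measurableSet_Ici

theorem integrable_weight {φ : ℝ → ℝ} (hφ : IsInteraction φ) {g : ℝ} (hg : 0 < g) (ν : ℝ) :
    Integrable (weight φ g ν) halfLine := by
  obtain ⟨R, hR⟩ := eventually_atTop.1 (hφ.tendsto_div.eventually_ge_atTop ((1 - ν) / g))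
  have hexp : Integrable (fun t : ℝ => Real.exp (-t)) halfLine := by
    have := (integrableOn_exp_neg_Ioi 0)
    exact (integrableOn_Ici_iff_integrableOn_Ioi).2 this
  have hm : AEMeasurable (weight φ g ν) halfLine := by
    unfold weight
    have := aemeasurable_interaction hφ
    fun_prop
  refine (hexp.const_mul (Real.exp ((|ν| + 1) * |R|))).mono' hm.aestronglyMeasurable ?_
  refine (ae_restrict_iff' measurableSet_Ici).2 (Eventually.of_forall fun t ht => ?_)
  have ht : 0 ≤ t := ht
  rw [weight, Real.norm_of_nonneg (Real.exp_pos _).le, ← Real.exp_add]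
  refine Real.exp_le_exp.2 ?_
  have h0 := mul_nonneg hg.le (hφ.nonneg t ht)
  have hν := neg_abs_le ν
  rcases le_or_gt t |R| with h | h
  · nlinarith [abs_nonneg ν, abs_nonneg R, mul_nonneg (abs_nonneg ν) (sub_nonneg.2 h)]
  · have htR : R ≤ t := (le_abs_self R).trans h.le
    have htp : 0 < t := (abs_nonneg R).trans_lt h
    have h1 := hR t htR
    rw [div_le_div_iff₀ hg htp] at h1
    have : 0 ≤ (|ν| + 1) * |R| := by positivity
    nlinarith

theorem memLp_kernel {φ : ℝ → ℝ} (hφ : IsInteraction φ) {g : ℝ} (hg : 0 < g) (ν : ℝ) :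
    MemLp (kernel φ g ν) 2 (halfLine.prod halfLine) := by
  have hw := integrable_weight hφ hg ν
  have hwm := hw.aemeasurable
  have hm : AEMeasurable (kernel φ g ν) (halfLine.prod halfLine) := by
    unfold kernel
    have h1 : AEMeasurable (fun z : ℝ × ℝ => weight φ g ν z.1) (halfLine.prod halfLine) :=
      hwm.comp_fst
    have h2 : AEMeasurable (fun z : ℝ × ℝ => weight φ g ν z.2) (halfLine.prod halfLine) :=
      hwm.comp_snd
    have h3 : AEMeasurable (fun z : ℝ × ℝ => besselI0 (2 * Real.sqrt (z.2 * z.1)))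
        (halfLine.prod halfLine) :=
      (measurable_besselI0.comp (by fun_prop)).aemeasurable
    fun_prop
  refine (memLp_two_iff_integrable_sq hm.aestronglyMeasurable).2 ?_
  refine (hw.mul_prod hw).mono' (hm.pow_const 2).aestronglyMeasurable ?_
  have hae : ∀ᵐ z ∂(halfLine.prod halfLine), 0 ≤ z.1 ∧ 0 ≤ z.2 := by
    unfold halfLine
    rw [Measure.prod_restrict]
    refine (ae_restrict_iff' (measurableSet_Ici.prod measurableSet_Ici)).2
      (Eventually.of_forall fun z hz => ?_)
    exact ⟨hz.1, hz.2⟩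
  filter_upwards [hae] with z hz
  obtain ⟨h1, h2⟩ := hz
  have hw1 : 0 ≤ weight φ g ν z.1 := (Real.exp_pos _).le
  have hw2 : 0 ≤ weight φ g ν z.2 := (Real.exp_pos _).le
  have hB : Real.exp (-z.1) * Real.exp (-z.2) * besselI0 (2 * Real.sqrt (z.2 * z.1)) ≤ 1 := by
    have hb := besselI0_le (2 * Real.sqrt (z.2 * z.1))
    rw [abs_of_nonneg (by positivity)] at hb
    calc _ ≤ Real.exp (-z.1) * Real.exp (-z.2) * Real.exp (2 * Real.sqrt (z.2 * z.1)) :=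
          mul_le_mul_of_nonneg_left hb (by positivity)
      _ ≤ 1 := by
          rw [← Real.exp_add, ← Real.exp_add, Real.exp_le_one_iff, Real.sqrt_mul h2]
          nlinarith [sq_nonneg (Real.sqrt z.1 - Real.sqrt z.2), Real.sq_sqrt h1, Real.sq_sqrt h2]
  have hB0 : 0 ≤ Real.exp (-z.1) * Real.exp (-z.2) * besselI0 (2 * Real.sqrt (z.2 * z.1)) :=
    mul_nonneg (by positivity) (besselI0_nonneg _)
  have e : kernel φ g ν z ^ 2 = weight φ g ν z.1 * weight φ g ν z.2 *
      (Real.exp (-z.1) * Real.exp (-z.2) * besselI0 (2 * Real.sqrt (z.2 * z.1))) ^ 2 := by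
    have e1 := Real.sq_sqrt hw1
    have e2 := Real.sq_sqrt hw2
    rw [kernel]
    linear_combination (Real.exp (-z.1) * Real.exp (-z.2) *
      besselI0 (2 * Real.sqrt (z.2 * z.1))) ^ 2 *
      (Real.sqrt (weight φ g ν z.2) ^ 2 * e1 + weight φ g ν z.1 * e2)
  rw [Real.norm_of_nonneg (sq_nonneg _), e]
  exact mul_le_of_le_one_right (mul_nonneg hw1 hw2) (pow_le_one₀ hB0 hB)

/-- The operator `Q = Q(g, ν)` on the real Hilbert space `L²[0, ∞)`,
`(Q f)(t) = ∫₀^∞ f(s) k₀(t, s) ds`. -/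
noncomputable def Q {φ : ℝ → ℝ} (hφ : IsInteraction φ) {g : ℝ} (hg : 0 < g) (ν : ℝ) :
    Lp ℝ 2 halfLine →L[ℝ] Lp ℝ 2 halfLine :=
  integralOperator (kernel φ g ν) (memLp_kernel hφ hg ν)

/-- `ν` is the critical parameter `ν_c(g)`: the operator norm of `Q(g, ν)` is `1`. -/
def IsCriticalParameter {φ : ℝ → ℝ} (hφ : IsInteraction φ) {g : ℝ} (hg : 0 < g) (ν : ℝ) : Prop :=
  ‖Q hφ hg ν‖ = 1

/-- `h` is a positive normalized eigenvector of `Q(g, ν)` with eigenvalue `1` (the leading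
eigenvalue when `ν = ν_c(g)`). -/
structure IsPositiveNormalizedEigenvector {φ : ℝ → ℝ} (hφ : IsInteraction φ) {g : ℝ} (hg : 0 < g)
    (ν : ℝ) (h : Lp ℝ 2 halfLine) : Prop where
  eigen : Q hφ hg ν h = h
  pos : ∀ᵐ t ∂halfLine, 0 < h t
  norm_eq_one : ‖h‖ = 1

end WSAW

/-! Write `h` for `h₀` and `fₙ` for `Qⁿ(t h)`. After clearing denominators, Andréief's identity
turns twice the difference of the two sides into the double integral of `h(x) h(y) (φ(x) y - φ(y) x)
(fₙ(x) h(y) - fₙ(y) h(x))`. The first bracket has the sign of `x - y` because `φ(t)/t` increases; so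
has the second if `fₙ/h` increases.

For `n = 0` the ratio `fₙ/h` is `t`. The induction step is `MonotoneRatio.Q_apply`: the kernel is
totally positive of order two, so `Q` preserves increasing ratios, and `Q h = h` keeps the
denominator fixed. Total positivity of the Bessel factor is Andréief again, over the counting
measure on `ℕ`. Strictness at `n = 0` holds since `φ(t)/t → ∞` makes the integrand positive on a
rectangle of positive measure. -/

namespace WSAW

/-! ### Andréief's identity and the resulting Chebyshev-type inequality. -/

section Chebyshev

variable {α : Type*} [MeasurableSpace α] {μ : Measure α}

/-- The two-dimensional Andréief (continuous Cauchy–Binet) identity. -/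
theorem integral_andreief [SFinite μ] {a b c d : α → ℝ}
    (hac : Integrable (fun x => a x * c x) μ) (hbd : Integrable (fun x => b x * d x) μ)
    (had : Integrable (fun x => a x * d x) μ) (hbc : Integrable (fun x => b x * c x) μ) :
    Integrable (fun z : α × α => (a z.1 * b z.2 - a z.2 * b z.1) *
        (c z.1 * d z.2 - c z.2 * d z.1)) (μ.prod μ) ∧
      ∫ z, (a z.1 * b z.2 - a z.2 * b z.1) * (c z.1 * d z.2 - c z.2 * d z.1) ∂(μ.prod μ)
        = 2 * ((∫ x, a x * c x ∂μ) * (∫ x, b x * d x ∂μ)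
          - (∫ x, a x * d x ∂μ) * ∫ x, b x * c x ∂μ) := by
  have e : (fun z : α × α => (a z.1 * b z.2 - a z.2 * b z.1) *
      (c z.1 * d z.2 - c z.2 * d z.1)) = fun z : α × α =>
      (((a z.1 * c z.1) * (b z.2 * d z.2) + (b z.1 * d z.1) * (a z.2 * c z.2))
        - ((a z.1 * d z.1) * (b z.2 * c z.2) + (b z.1 * c z.1) * (a z.2 * d z.2))) := by
    funext z; ring
  have h1 := hac.mul_prod hbd
  have h2 := hbd.mul_prod hac
  have h3 := had.mul_prod hbc
  have h4 := hbc.mul_prod had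
  rw [e]
  refine ⟨(h1.add h2).sub (h3.add h4), ?_⟩
  refine (integral_sub (h1.add h2) (h3.add h4)).trans ?_
  rw [integral_add' h1 h2, integral_add' h3 h4]
  rw [integral_prod_mul (fun x => a x * c x) (fun x => b x * d x),
    integral_prod_mul (fun x => b x * d x) (fun x => a x * c x),
    integral_prod_mul (fun x => a x * d x) (fun x => b x * c x),
    integral_prod_mul (fun x => b x * c x) (fun x => a x * d x)]
  ring

/-- Used at three levels: for power series (counting measure), for the action of `Q`, and for the
final inequality. -/
theorem integral_mul_integral_le_of_andreief [SFinite μ] {a b c d : α → ℝ}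
    (hac : Integrable (fun x => a x * c x) μ) (hbd : Integrable (fun x => b x * d x) μ)
    (had : Integrable (fun x => a x * d x) μ) (hbc : Integrable (fun x => b x * c x) μ)
    (h : ∀ᵐ z ∂(μ.prod μ), 0 ≤ (a z.1 * b z.2 - a z.2 * b z.1) *
      (c z.1 * d z.2 - c z.2 * d z.1)) :
    (∫ x, a x * d x ∂μ) * (∫ x, b x * c x ∂μ)
      ≤ (∫ x, a x * c x ∂μ) * ∫ x, b x * d x ∂μ := by
  have h0 := integral_nonneg_of_ae h
  rw [(integral_andreief hac hbd had hbc).2] at h0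
  linarith

end Chebyshev

/-! ### Total positivity of the kernel -/

theorem sub_mul_sub_pow_nonneg {x y : ℝ} (hx : 0 ≤ x) (hy : 0 ≤ y) (n k : ℕ) :
    0 ≤ (x - y) * (x ^ (n + k) * y ^ n - x ^ n * y ^ (n + k)) := by
  have h : 0 ≤ (x - y) * (x ^ k - y ^ k) := by
    rcases le_total x y with hxy | hxy
    · exact mul_nonneg_of_nonpos_of_nonpos (sub_nonpos.2 hxy)
        (sub_nonpos.2 (pow_le_pow_left₀ hx hxy k))
    · exact mul_nonneg (sub_nonneg.2 hxy) (sub_nonneg.2 (pow_le_pow_left₀ hy hxy k))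
  calc 0 ≤ (x ^ n * y ^ n) * ((x - y) * (x ^ k - y ^ k)) := by positivity
    _ = _ := by ring

/-- Both factors have the sign of `m - n`. Multiplying by `x - y` and `u - v` expresses total
positivity without ordering the points. -/
theorem monomial_totallyPositive {x y u v : ℝ} (hx : 0 ≤ x) (hy : 0 ≤ y) (hu : 0 ≤ u)
    (hv : 0 ≤ v) (m n : ℕ) :
    0 ≤ ((x - y) * (x ^ m * y ^ n - x ^ n * y ^ m)) *
      ((u - v) * (u ^ m * v ^ n - u ^ n * v ^ m)) := by
  rcases le_total n m with h | h
  · obtain ⟨k, rfl⟩ := Nat.exists_eq_add_of_le h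
    exact mul_nonneg (sub_mul_sub_pow_nonneg hx hy n k) (sub_mul_sub_pow_nonneg hu hv n k)
  · obtain ⟨k, rfl⟩ := Nat.exists_eq_add_of_le h
    have := mul_nonneg (sub_mul_sub_pow_nonneg hx hy m k) (sub_mul_sub_pow_nonneg hu hv m k)
    linarith

theorem besselI0_two_sqrt {x : ℝ} (hx : 0 ≤ x) :
    HasSum (fun m : ℕ => x ^ m / ((m.factorial : ℝ) * m.factorial))
      (besselI0 (2 * Real.sqrt x)) := by
  have e : (fun m : ℕ => x ^ m / ((m.factorial : ℝ) * m.factorial)) = fun m : ℕ =>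
      (1 / ((m.factorial : ℝ) * (m.factorial : ℝ))) * (2 * Real.sqrt x / 2) ^ (2 * m) := by
    funext m
    rw [mul_div_cancel_left₀ _ (two_ne_zero), pow_mul, Real.sq_sqrt hx]
    ring
  rw [e]
  exact (besselI0_summable (2 * Real.sqrt x)).hasSum

/-- `I₀(2√(ux)) = ∑ (xᵐ/m!²) uᵐ` is a composition of two totally positive monomial kernels, so
Andréief over `ℕ` applies. -/
theorem besselI0_totallyPositive {x y u v : ℝ} (hx : 0 ≤ x) (hy : 0 ≤ y) (hu : 0 ≤ u)
    (hv : 0 ≤ v) :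
    0 ≤ ((x - y) * (u - v)) *
      (besselI0 (2 * Real.sqrt (u * x)) * besselI0 (2 * Real.sqrt (v * y))
        - besselI0 (2 * Real.sqrt (u * y)) * besselI0 (2 * Real.sqrt (v * x))) := by
  let σ := (x - y) * (u - v)
  have key : ∀ {p q : ℝ}, 0 ≤ p → 0 ≤ q →
      HasSum (fun m : ℕ => (p ^ m / ((m.factorial : ℝ) * m.factorial)) * q ^ m)
        (besselI0 (2 * Real.sqrt (q * p))) := by
    intro p q hp hq
    convert besselI0_two_sqrt (mul_nonneg hq hp) using 2 with m
    rw [mul_pow]; ring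
  -- Sums of nonnegative series become integrals against the counting measure.
  have int : ∀ {f : ℕ → ℝ} {A : ℝ}, (∀ m, 0 ≤ f m) → HasSum f A →
      Integrable f Measure.count ∧ ∫ m, f m ∂Measure.count = A := by
    intro f A hf h
    have hi : Integrable f Measure.count := by
      rw [integrable_count_iff]
      exact h.summable.congr fun m => (Real.norm_of_nonneg (hf m)).symm
    refine ⟨hi, ?_⟩
    rw [integral_countable hi, ← h.tsum_eq]
    simp [Measure.real]
  have hxu := int (fun m => by positivity) (key hx hu)
  have hxv := int (fun m => by positivity) (key hx hv)
  have hyu := int (fun m => by positivity) (key hy hu)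
  have hyv := int (fun m => by positivity) (key hy hv)
  have h := integral_mul_integral_le_of_andreief (μ := (Measure.count : Measure ℕ))
    (a := fun m => σ * (x ^ m / ((m.factorial : ℝ) * m.factorial)))
    (b := fun m => y ^ m / ((m.factorial : ℝ) * m.factorial))
    (c := fun m => u ^ m) (d := fun m => v ^ m)
    (by simpa only [mul_assoc] using hxu.1.const_mul σ) hyv.1
    (by simpa only [mul_assoc] using hxv.1.const_mul σ) hyu.1
    (Eventually.of_forall fun z => by
      have h := monomial_totallyPositive hx hy hu hv z.1 z.2
      have hc : 0 ≤ 1 / (((z.1.factorial : ℝ) * z.1.factorial) *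
        ((z.2.factorial : ℝ) * z.2.factorial)) := by positivity
      have := mul_nonneg hc h
      refine this.trans_eq ?_
      simp only [σ]
      field_simp)
  simp only [mul_assoc, integral_const_mul] at h
  rw [hxu.2, hxv.2, hyu.2, hyv.2] at h
  change 0 ≤ σ * _
  linarith

/-- The remaining factors of the kernel depend on one variable each, so they pull out of the
determinant as a common nonnegative factor. -/
theorem kernel_totallyPositive (φ : ℝ → ℝ) (g ν : ℝ) {x y u v : ℝ} (hx : 0 ≤ x) (hy : 0 ≤ y)
    (hu : 0 ≤ u) (hv : 0 ≤ v) :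
    0 ≤ ((x - y) * (u - v)) * (kernel φ g ν (x, u) * kernel φ g ν (y, v)
      - kernel φ g ν (y, u) * kernel φ g ν (x, v)) := by
  have h := besselI0_totallyPositive hx hy hu hv
  have hc : 0 ≤ Real.sqrt (weight φ g ν x) * Real.sqrt (weight φ g ν y) *
    Real.sqrt (weight φ g ν u) * Real.sqrt (weight φ g ν v) *
    (Real.exp (-x) * Real.exp (-y) * Real.exp (-u) * Real.exp (-v)) := by positivity
  refine (mul_nonneg hc h).trans_eq ?_
  simp only [kernel]
  ring

/-! ### `Q` preserves monotone ratios -/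

/-- The quotient `f / h` is almost everywhere increasing, in a form without division. -/
def MonotoneRatio (f h : ℝ → ℝ) : Prop :=
  ∀ᵐ z ∂(halfLine.prod halfLine), 0 ≤ (z.1 - z.2) * (f z.1 * h z.2 - f z.2 * h z.1)

theorem ae_prod_of_ae {p : ℝ → Prop} (h : ∀ᵐ t ∂halfLine, p t) :
    ∀ᵐ z ∂(halfLine.prod halfLine), p z.1 ∧ p z.2 :=
  (Measure.quasiMeasurePreserving_fst.ae h).and (Measure.quasiMeasurePreserving_snd.ae h)

theorem ae_halfLine_nonneg : ∀ᵐ t ∂halfLine, 0 ≤ t := ae_restrict_mem measurableSet_Ici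

theorem Q_apply_ae {φ : ℝ → ℝ} (hφ : IsInteraction φ) {g : ℝ} (hg : 0 < g) (ν : ℝ)
    (f : Lp ℝ 2 halfLine) :
    ∀ᵐ t ∂halfLine, Q hφ hg ν f t = ∫ s, kernel φ g ν (t, s) * f s ∂halfLine :=
  (memLp_kernel_apply (memLp_kernel hφ hg ν) f).coeFn_toLp

theorem MonotoneRatio.Q_apply {φ : ℝ → ℝ} (hφ : IsInteraction φ) {g : ℝ} (hg : 0 < g) (ν : ℝ)
    {f h : Lp ℝ 2 halfLine} (hfh : MonotoneRatio f h) :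
    MonotoneRatio (Q hφ hg ν f) (Q hφ hg ν h) := by
  filter_upwards [ae_prod_of_ae (Q_apply_ae hφ hg ν f), ae_prod_of_ae (Q_apply_ae hφ hg ν h),
    ae_prod_of_ae (ae_memLp_kernel (memLp_kernel hφ hg ν)), ae_prod_of_ae ae_halfLine_nonneg]
    with z hf hh hk hz
  obtain ⟨x, y⟩ := z
  simp only at hf hh hk hz ⊢
  have ixf := (hk.1.integrable_mul (Lp.memLp f)).const_mul (x - y)
  have ixh := (hk.1.integrable_mul (Lp.memLp h)).const_mul (x - y)
  have iyf := hk.2.integrable_mul (Lp.memLp f)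
  have iyh := hk.2.integrable_mul (Lp.memLp h)
  have key := integral_mul_integral_le_of_andreief (μ := halfLine)
    (a := fun u => (x - y) * kernel φ g ν (x, u)) (b := fun u => kernel φ g ν (y, u))
    (c := f) (d := h) (by simpa only [mul_assoc, Pi.mul_apply] using ixf) iyh
    (by simpa only [mul_assoc, Pi.mul_apply] using ixh) iyf (by
      filter_upwards [hfh, ae_prod_of_ae ae_halfLine_nonneg] with w hw hw0
      have h1 := kernel_totallyPositive φ g ν hz.1 hz.2 hw0.1 hw0.2
      -- Multiplying the two sign conditions creates a factor `(w.1 - w.2)²`; it cancels off the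
      -- diagonal, and on the diagonal the determinants vanish.
      rcases eq_or_ne w.1 w.2 with he | he
      · simp [he]
      · have hp : 0 < (w.1 - w.2) ^ 2 := by
          have := sub_ne_zero.2 he
          positivity
        refine nonneg_of_mul_nonneg_right ((mul_nonneg h1 hw).trans_eq ?_) hp
        ring)
  simp only [mul_assoc, integral_const_mul] at key
  rw [hf.1, hf.2, hh.1, hh.2]
  linarith

theorem MonotoneRatio.Q_pow_apply {φ : ℝ → ℝ} (hφ : IsInteraction φ) {g : ℝ} (hg : 0 < g)
    (ν : ℝ) {f h : Lp ℝ 2 halfLine} (hfh : MonotoneRatio f h) (hh : Q hφ hg ν h = h) (n : ℕ) :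
    MonotoneRatio ((Q hφ hg ν ^ n) f) h := by
  induction n with
  | zero => exact hfh
  | succ n ih =>
    have := ih.Q_apply hφ hg ν
    rwa [hh, ← mul_apply_eq_comp, ← pow_succ'] at this

/-! ### Decay of the eigenvector -/

/-- `I₀(z) ≤ exp |z|` bounds the Bessel and exponential factors together by `exp (-(√t - √s)²) ≤ 1`.
-/
theorem sq_kernel_le (φ : ℝ → ℝ) (g ν : ℝ) {t s : ℝ} (ht : 0 ≤ t) (hs : 0 ≤ s) :
    kernel φ g ν (t, s) ^ 2 ≤ weight φ g ν t * weight φ g ν s := by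
  have hw1 : 0 ≤ weight φ g ν t := (Real.exp_pos _).le
  have hw2 : 0 ≤ weight φ g ν s := (Real.exp_pos _).le
  have hB : Real.exp (-t) * Real.exp (-s) * besselI0 (2 * Real.sqrt (s * t)) ≤ 1 := by
    have hb := besselI0_le (2 * Real.sqrt (s * t))
    rw [abs_of_nonneg (by positivity)] at hb
    refine (mul_le_mul_of_nonneg_left hb (by positivity)).trans ?_
    rw [← Real.exp_add, ← Real.exp_add, Real.exp_le_one_iff, Real.sqrt_mul hs]
    nlinarith [sq_nonneg (Real.sqrt t - Real.sqrt s), Real.sq_sqrt ht, Real.sq_sqrt hs]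
  have hB0 : 0 ≤ Real.exp (-t) * Real.exp (-s) * besselI0 (2 * Real.sqrt (s * t)) :=
    mul_nonneg (by positivity) (besselI0_nonneg _)
  have e : kernel φ g ν (t, s) ^ 2 = weight φ g ν t * weight φ g ν s *
      (Real.exp (-t) * Real.exp (-s) * besselI0 (2 * Real.sqrt (s * t))) ^ 2 := by
    rw [kernel]
    linear_combination (Real.exp (-t) * Real.exp (-s) * besselI0 (2 * Real.sqrt (s * t))) ^ 2 *
      (Real.sqrt (weight φ g ν s) ^ 2 * Real.sq_sqrt hw1 + weight φ g ν t * Real.sq_sqrt hw2)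
  rw [e]
  exact mul_le_of_le_one_right (mul_nonneg hw1 hw2) (pow_le_one₀ hB0 hB)

/-- Cauchy–Schwarz in `s`: functions in the range of `Q` decay pointwise like `√p`. -/
theorem sq_Q_apply_le {φ : ℝ → ℝ} (hφ : IsInteraction φ) {g : ℝ} (hg : 0 < g) (ν : ℝ)
    (f : Lp ℝ 2 halfLine) :
    ∃ C : ℝ, ∀ᵐ t ∂halfLine, Q hφ hg ν f t ^ 2 ≤ C * weight φ g ν t := by
  refine ⟨(∫ s, weight φ g ν s ∂halfLine) * ‖f‖ ^ 2, ?_⟩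
  filter_upwards [Q_apply_ae hφ hg ν f, sq_kernel_apply_le (memLp_kernel hφ hg ν) f,
    ae_memLp_kernel (memLp_kernel hφ hg ν), ae_halfLine_nonneg] with t h1 h2 h3 ht
  rw [h1]
  have h4 : ∫ s, kernel φ g ν (t, s) ^ 2 ∂halfLine
      ≤ weight φ g ν t * ∫ s, weight φ g ν s ∂halfLine := by
    rw [← integral_const_mul]
    refine integral_mono_ae h3.integrable_sq ((integrable_weight hφ hg ν).const_mul _) ?_
    filter_upwards [ae_halfLine_nonneg] with s hs
    exact sq_kernel_le φ g ν ht hs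
  refine h2.trans ((mul_le_mul_of_nonneg_right h4 (sq_nonneg _)).trans_eq ?_)
  ring

theorem sq_le_exp {x c : ℝ} (hc : 0 < c) (hx : 0 ≤ x) : x ^ 2 ≤ 2 / c ^ 2 * Real.exp (c * x) := by
  have h := Real.pow_div_factorial_le_exp (x := c * x) (by positivity) 2
  rw [div_mul_eq_mul_div, le_div_iff₀ (by positivity)]
  norm_num [Nat.factorial] at h
  nlinarith

/-- Multiplication by `a` maps the range of `Q` into `L²` as soon as `a² p` is bounded by
another integrable weight. -/
theorem memLp_mul_of_sq_weight_le {φ : ℝ → ℝ} (hφ : IsInteraction φ) {g : ℝ} (hg : 0 < g)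
    (ν : ℝ) (f : Lp ℝ 2 halfLine) {a : ℝ → ℝ} (ha : AEMeasurable a halfLine)
    {g' ν' c : ℝ} (hg' : 0 < g')
    (hle : ∀ t, 0 ≤ t → a t ^ 2 * weight φ g ν t ≤ c * weight φ g' ν' t) :
    MemLp (fun t => a t * Q hφ hg ν f t) 2 halfLine := by
  obtain ⟨C, hC⟩ := sq_Q_apply_le hφ hg ν f
  have hm : AEStronglyMeasurable (fun t => a t * Q hφ hg ν f t) halfLine :=
    ha.aestronglyMeasurable.mul (Lp.aestronglyMeasurable _)
  refine (memLp_two_iff_integrable_sq hm).2 ?_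
  refine ((integrable_weight hφ hg' ν').const_mul (|C| * c)).mono' (hm.pow 2) ?_
  filter_upwards [hC, ae_halfLine_nonneg] with t h1 ht
  have hw : 0 ≤ weight φ g ν t := (Real.exp_pos _).le
  rw [Real.norm_of_nonneg (sq_nonneg _), mul_pow]
  calc a t ^ 2 * Q hφ hg ν f t ^ 2 ≤ a t ^ 2 * (|C| * weight φ g ν t) := by
        refine mul_le_mul_of_nonneg_left (h1.trans ?_) (sq_nonneg _)
        exact mul_le_mul_of_nonneg_right (le_abs_self C) hw
    _ = |C| * (a t ^ 2 * weight φ g ν t) := by ring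
    _ ≤ |C| * (c * weight φ g' ν' t) := mul_le_mul_of_nonneg_left (hle t ht) (abs_nonneg C)
    _ = _ := by ring

theorem memLp_id_mul_Q {φ : ℝ → ℝ} (hφ : IsInteraction φ) {g : ℝ} (hg : 0 < g) (ν : ℝ)
    (f : Lp ℝ 2 halfLine) : MemLp (fun t => t * Q hφ hg ν f t) 2 halfLine := by
  -- The bound `t² ≤ 2 eᵗ` costs a shift of `ν` by one.
  refine memLp_mul_of_sq_weight_le hφ hg ν f (a := fun t => t) aemeasurable_id hg
    (ν' := ν - 1) (c := 2 / 1 ^ 2) ?_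
  intro t ht
  refine (mul_le_mul_of_nonneg_right (sq_le_exp one_pos ht) (Real.exp_pos _).le).trans_eq ?_
  rw [mul_assoc]
  simp only [weight]
  rw [← Real.exp_add]
  ring_nf

theorem memLp_interaction_mul_Q {φ : ℝ → ℝ} (hφ : IsInteraction φ) {g : ℝ} (hg : 0 < g) (ν : ℝ)
    (f : Lp ℝ 2 halfLine) : MemLp (fun t => φ t * Q hφ hg ν f t) 2 halfLine := by
  -- Here `φ²` is absorbed by giving up half of `g`.
  refine memLp_mul_of_sq_weight_le hφ hg ν f (aemeasurable_interaction hφ) (half_pos hg)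
    (ν' := ν) (c := 2 / (g / 2) ^ 2) ?_
  intro t ht
  refine (mul_le_mul_of_nonneg_right (sq_le_exp (half_pos hg) (hφ.nonneg t ht))
    (Real.exp_pos _).le).trans_eq ?_
  rw [mul_assoc]
  simp only [weight]
  rw [← Real.exp_add]
  ring_nf

/-! ### Monotonicity of `φ(t) / t` -/

theorem IsInteraction.mul_sub_nonneg {φ : ℝ → ℝ} (hφ : IsInteraction φ) {x y : ℝ} (hx : 0 ≤ x)
    (hy : 0 ≤ y) : 0 ≤ (x - y) * (φ x * y - φ y * x) := by
  rcases hx.eq_or_lt with rfl | hx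
  · simp [hφ.zero]
  rcases hy.eq_or_lt with rfl | hy
  · simp [hφ.zero]
  have h : 0 ≤ (x - y) * (φ x / x - φ y / y) := by
    rcases le_total x y with hxy | hxy
    · exact mul_nonneg_of_nonpos_of_nonpos (sub_nonpos.2 hxy)
        (sub_nonpos.2 (hφ.monotone_div hx hy hxy))
    · exact mul_nonneg (sub_nonneg.2 hxy) (sub_nonneg.2 (hφ.monotone_div hy hx hxy))
  refine (mul_nonneg (mul_pos hx hy).le h).trans_eq ?_
  field_simp

/-- By monotonicity `φ(y)/y ≤ φ(1)` on `(0, 1)`, while superlinear growth gives `φ(x)/x > φ(1)`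
beyond some `R`. -/
theorem IsInteraction.exists_strict {φ : ℝ → ℝ} (hφ : IsInteraction φ) :
    ∃ R : ℝ, 1 ≤ R ∧ (∀ t, R < t → 0 < φ t) ∧
      ∀ x y, R < x → 0 < y → y < 1 → 0 < (x - y) * (φ x * y - φ y * x) := by
  obtain ⟨R, hR⟩ := eventually_atTop.1 (hφ.tendsto_div.eventually_gt_atTop (max 0 (φ 1 / 1)))
  refine ⟨max 1 R, le_max_left _ _, ?_, ?_⟩
  · intro t ht
    obtain ⟨h1, h2⟩ := max_lt_iff.1 ht
    have := (le_max_left _ _).trans_lt (hR t h2.le)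
    exact (div_pos_iff_of_pos_right (by linarith)).1 this
  · intro x y hx hy hy1
    obtain ⟨h1, h2⟩ := max_lt_iff.1 hx
    have hx0 : 0 < x := by linarith
    have h3 := (le_max_right _ _).trans_lt (hR x h2.le)
    have h4 : φ y / y ≤ φ 1 / 1 := hφ.monotone_div hy (mem_Ioi.2 one_pos) hy1.le
    have h5 := h4.trans_lt h3
    rw [div_lt_div_iff₀ hy hx0] at h5
    exact mul_pos (by linarith) (by linarith)

/-! ### Positivity of integrals and the sign of the Andréief integrand. -/

theorem halfLine_Ioo_ne_zero {a b : ℝ} (ha : 0 ≤ a) (hab : a < b) : halfLine (Ioo a b) ≠ 0 := by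
  have : Ioo a b ∩ Ici 0 = Ioo a b :=
    inter_eq_left.2 fun x hx => ha.trans hx.1.le
  rw [halfLine, Measure.restrict_apply measurableSet_Ioo, this, Real.volume_Ioo]
  simpa using hab

theorem inner_toLp_right {μ : Measure ℝ} (f : Lp ℝ 2 μ) {u : ℝ → ℝ} (hu : MemLp u 2 μ) :
    inner ℝ f (hu.toLp u) = ∫ s, u s * f s ∂μ := by
  rw [L2.inner_def]
  refine integral_congr_ae ?_
  filter_upwards [hu.coeFn_toLp] with s h1
  simp [h1]

theorem integral_pos_of_ae_of_measure_ne_zero {α : Type*} [MeasurableSpace α] {μ : Measure α}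
    {f : α → ℝ} (hf : Integrable f μ) (h0 : 0 ≤ᵐ[μ] f) {s : Set α} (hs : μ s ≠ 0)
    (hpos : ∀ᵐ x ∂μ, x ∈ s → 0 < f x) : 0 < ∫ x, f x ∂μ := by
  refine (integral_pos_iff_support_of_nonneg_ae h0 hf).2 (pos_iff_ne_zero.2 fun h => hs ?_)
  have h' : ∀ᵐ x ∂μ, ¬ f x ≠ 0 := by simpa [ae_iff, Function.support] using h
  rw [← compl_compl s, ← mem_ae_iff]
  filter_upwards [h', hpos] with x h1 h2 h3
  exact h1 (h2 h3).ne'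

theorem ae_andreief_nonneg {φ : ℝ → ℝ} (hφ : IsInteraction φ) {f h : ℝ → ℝ}
    (hfh : MonotoneRatio f h) (hpos : ∀ᵐ t ∂halfLine, 0 < h t) :
    ∀ᵐ z ∂(halfLine.prod halfLine), 0 ≤
      ((φ z.1 * h z.1) * (z.2 * h z.2) - (φ z.2 * h z.2) * (z.1 * h z.1)) *
        (f z.1 * h z.2 - f z.2 * h z.1) := by
  filter_upwards [hfh, ae_prod_of_ae hpos, ae_prod_of_ae ae_halfLine_nonneg] with z h1 h2 h0
  rcases eq_or_ne z.1 z.2 with he | he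
  · simp [he]
  · have hp : 0 < (z.1 - z.2) ^ 2 := by
      have := sub_ne_zero.2 he
      positivity
    refine nonneg_of_mul_nonneg_right ((mul_nonneg (mul_pos h2.1 h2.2).le
      (mul_nonneg (hφ.mul_sub_nonneg h0.1 h0.2) h1)).trans_eq ?_) hp
    ring

theorem monotoneRatio_id_mul {h f : ℝ → ℝ} (hf : f =ᵐ[halfLine] fun t => t * h t)
    (hpos : ∀ᵐ t ∂halfLine, 0 < h t) : MonotoneRatio f h := by
  filter_upwards [ae_prod_of_ae hf, ae_prod_of_ae hpos] with z hz h2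
  rw [hz.1, hz.2]
  refine (mul_nonneg (mul_pos h2.1 h2.2).le (sq_nonneg (z.1 - z.2))).trans_eq ?_
  ring

end WSAW

open WSAW in
theorem mainTheorem5 (φ : ℝ → ℝ) (hφ : WSAW.IsInteraction φ) (g₀ : ℝ) (hg₀ : 0 < g₀) (ν₀ : ℝ)
    (hν₀ : WSAW.IsCriticalParameter hφ hg₀ ν₀) (h₀ : Lp ℝ 2 WSAW.halfLine)
    (hh₀ : WSAW.IsPositiveNormalizedEigenvector hφ hg₀ ν₀ h₀) :
    ∃ (ht : MemLp (fun t => t * h₀ t) 2 WSAW.halfLine)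
      (hφt : MemLp (fun t => φ t * h₀ t) 2 WSAW.halfLine),
      0 < (∫ s in Ici (0 : ℝ), φ s * h₀ s ^ 2) ∧
      0 < (∫ s in Ici (0 : ℝ), s * h₀ s ^ 2) ∧
      (∀ n : ℕ,
        inner ℝ ((WSAW.Q hφ hg₀ ν₀ ^ n) (ht.toLp _)) (hφt.toLp _) /
            (∫ s in Ici (0 : ℝ), φ s * h₀ s ^ 2)
          ≥ inner ℝ ((WSAW.Q hφ hg₀ ν₀ ^ n) (ht.toLp _)) (ht.toLp _) /
            (∫ s in Ici (0 : ℝ), s * h₀ s ^ 2)) ∧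
      inner ℝ ((WSAW.Q hφ hg₀ ν₀ ^ 0) (ht.toLp _)) (hφt.toLp _) /
            (∫ s in Ici (0 : ℝ), φ s * h₀ s ^ 2)
          > inner ℝ ((WSAW.Q hφ hg₀ ν₀ ^ 0) (ht.toLp _)) (ht.toLp _) /
            (∫ s in Ici (0 : ℝ), s * h₀ s ^ 2) := by
  have ht := memLp_id_mul_Q hφ hg₀ ν₀ h₀
  have hφt := memLp_interaction_mul_Q hφ hg₀ ν₀ h₀
  -- Since `h₀ = Q h₀`, the decay estimates for the range of `Q` apply to `h₀`.
  rw [hh₀.eigen] at ht hφt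
  obtain ⟨R, hR1, hRpos, hRstrict⟩ := hφ.exists_strict
  have hφh : Integrable (fun s => φ s * h₀ s * h₀ s) halfLine :=
    hφt.integrable_mul (Lp.memLp h₀)
  have hth : Integrable (fun s => s * h₀ s * h₀ s) halfLine :=
    ht.integrable_mul (Lp.memLp h₀)
  have eφ : ∫ s in Ici (0 : ℝ), φ s * h₀ s ^ 2 = ∫ s, φ s * h₀ s * h₀ s ∂halfLine := by
    simp only [sq, mul_assoc, halfLine]
  have et : ∫ s in Ici (0 : ℝ), s * h₀ s ^ 2 = ∫ s, s * h₀ s * h₀ s ∂halfLine := by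
    simp only [sq, mul_assoc, halfLine]
  have pφ : 0 < ∫ s, φ s * h₀ s * h₀ s ∂halfLine := by
    -- `φ` may vanish near `0`, so an interval beyond `R` is used.
    refine integral_pos_of_ae_of_measure_ne_zero hφh ?_
      (halfLine_Ioo_ne_zero (a := R) (b := R + 1) (by linarith) (by linarith)) ?_
    · filter_upwards [ae_halfLine_nonneg, hh₀.pos] with t h1 h2
      exact mul_nonneg (mul_nonneg (hφ.nonneg t h1) h2.le) h2.le
    · filter_upwards [hh₀.pos] with t h2 hm
      exact mul_pos (mul_pos (hRpos t hm.1) h2) h2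
  have pt : 0 < ∫ s, s * h₀ s * h₀ s ∂halfLine := by
    refine integral_pos_of_ae_of_measure_ne_zero hth ?_
      (halfLine_Ioo_ne_zero (a := 0) (b := 1) le_rfl one_pos) ?_
    · filter_upwards [ae_halfLine_nonneg, hh₀.pos] with t h1 h2
      exact mul_nonneg (mul_nonneg h1 h2.le) h2.le
    · filter_upwards [hh₀.pos] with t h2 hm
      exact mul_pos (mul_pos hm.1 h2) h2
  have hmono : MonotoneRatio (ht.toLp _) h₀ := monotoneRatio_id_mul ht.coeFn_toLp hh₀.pos
  refine ⟨ht, hφt, eφ ▸ pφ, et ▸ pt, fun n => ?_, ?_⟩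
  · rw [eφ, et, ge_iff_le, div_le_div_iff₀ pt pφ, inner_toLp_right, inner_toLp_right, mul_comm]
    exact integral_mul_integral_le_of_andreief
      (hφt.integrable_mul (Lp.memLp _)) hth hφh (ht.integrable_mul (Lp.memLp _))
      (ae_andreief_nonneg hφ (hmono.Q_pow_apply hφ hg₀ ν₀ hh₀.eigen n) hh₀.pos)
  · rw [eφ, et, gt_iff_lt, div_lt_div_iff₀ pt pφ, inner_toLp_right, inner_toLp_right, mul_comm,
      pow_zero, one_apply_eq_self]
    obtain ⟨hint, heq⟩ := integral_andreief (μ := halfLine) (c := ht.toLp _)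
      (hφt.integrable_mul (Lp.memLp _)) hth hφh (ht.integrable_mul (Lp.memLp _))
    have hs : (halfLine.prod halfLine) (Ioo R (R + 1) ×ˢ Ioo 0 1) ≠ 0 := by
      rw [Measure.prod_prod]
      exact mul_ne_zero (halfLine_Ioo_ne_zero (by linarith) (by linarith))
        (halfLine_Ioo_ne_zero le_rfl one_pos)
    have hpos := integral_pos_of_ae_of_measure_ne_zero hint
      (ae_andreief_nonneg hφ hmono hh₀.pos) hs (by
        filter_upwards [ae_prod_of_ae ht.coeFn_toLp, ae_prod_of_ae hh₀.pos] with z h1 h2 hz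
        rw [h1.1, h1.2]
        have h3 := hRstrict z.1 z.2 hz.1.1 hz.2.1 hz.2.2
        -- For `n = 0` the second determinant is `h₀(x) h₀(y) (x - y)`, so the integrand is `(h₀(x)
        -- h₀(y))²` times the expression in `h3`.
        refine (mul_pos (pow_pos (mul_pos h2.1 h2.2) 2) h3).trans_eq ?_
        ring)
    rw [heq] at hpos
    linarith
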